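/- For real numbers $\varepsilon,\delta$ let $I$ be the identity, let $X=\begin{pmatrix}0&1\\1&0\end{pmatrix}$, $Z=\begin{pmatrix}1&0\\0&-1\end{pmatrix}$, and on $\mathbb C^2\otimes\mathbb C^2$ put $$\rho_{12}=\tfrac14(I+\varepsilon\,X\otimes X),\qquad \rho_{23}=\tfrac14(I+\delta\,Z\otimes Z).$$ A completion of $(\rho_{12},\rho_{23})$ is a positive definite operator $\omega$ of trace one on $(\mathbb C^2)^{\otimes 3}$ whose partial traces satisfy $\mathrm{Tr}_3(\omega)=\rho_{12}$ and $\mathrm{Tr}_1(\omega)=\rho_{23}$. With $S(\rho)=-\mathrm{Tr}(\rho\log\rho)$, a completion $\omega$ is called quantum Markov if $I(1:3\,|\,2)_\omega=S(\omega_{12})+S(\omega_{23})-S(\omega_2)-S(\omega)=0$. Lemma. Assume $\varepsilon^2+\delta^2<1$. Then: 1. the marginals $(\rho_{12},\rho_{23})$ are feasible, that is, they have a completion; 2. they have a quantum Markov completion if and only if $\varepsilon\delta=0$; 3. among all completions there is exactly one of maximal entropy $S$, namely $\sigma=\tfrac18\bigl(I+\varepsilon\,X\otimes X\otimes I+\delta\,I\otimes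 Z\otimes Z\bigr)$; 4. if $\varepsilon\delta\neq0$, the maximum-entropy completion $\sigma$ is not quantum Markov. In particular, feasibility does not imply the existence of a quantum Markov completion. -/

import Mathlib

open scoped ComplexOrder Kronecker

namespace QMarkov

noncomputable section

/-- A strictly positive density operator: positive definite (in particular self-adjoint) with
trace one. -/
def IsDensity {n : Type*} [Fintype n] (ρ : Matrix n n ℂ) : Prop :=
  ρ.PosDef ∧ ρ.trace = 1

/-- Partial trace over the first tensor factor. -/
def traceFst {m n : Type*} [Fintype m] (M : Matrix (m × n) (m × n) ℂ) : Matrix n n ℂ :=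
  Matrix.of fun j j' => ∑ i, M (i, j) (i, j')

/-- Partial trace over the second tensor factor. -/
def traceSnd {m n : Type*} [Fintype n] (M : Matrix (m × n) (m × n) ℂ) : Matrix m m ℂ :=
  Matrix.of fun i i' => ∑ j, M (i, j) (i', j)

/-- The marginal on systems `1, 2` of an operator on three systems `1, 2, 3`. -/
def marg12 {a c b : Type*} [Fintype b] (ω : Matrix (a × c × b) (a × c × b) ℂ) :
    Matrix (a × c) (a × c) ℂ :=
  traceSnd (ω.submatrix (Equiv.prodAssoc a c b) (Equiv.prodAssoc a c b))

/-- The marginal on systems `2, 3` of an operator on three systems `1, 2, 3`. -/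
def marg23 {a c b : Type*} [Fintype a] (ω : Matrix (a × c × b) (a × c × b) ℂ) :
    Matrix (c × b) (c × b) ℂ :=
  traceFst ω

/-- The marginal on system `2` of an operator on three systems `1, 2, 3`. -/
def marg2 {a c b : Type*} [Fintype a] [Fintype b] (ω : Matrix (a × c × b) (a × c × b) ℂ) :
    Matrix c c ℂ :=
  traceSnd (marg23 ω)

/-- The von Neumann entropy `S(ρ) = - Tr (ρ log ρ)`; the logarithm of a self-adjoint matrix is
given by the functional calculus, and the trace is real, so taking its real part loses nothing. -/
def entropy {n : Type*} [Fintype n] [DecidableEq n] (ρ : Matrix n n ℂ) : ℝ :=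
  -((ρ * cfc Real.log ρ).trace).re

section Tripartite

variable {a c b : Type*} [Fintype a] [Fintype c] [Fintype b]
  [DecidableEq a] [DecidableEq c] [DecidableEq b]

/-- The quantum conditional mutual information `I(1 : 3 | 2)` of a tripartite state. -/
def condMutualInfo (ω : Matrix (a × c × b) (a × c × b) ℂ) : ℝ :=
  entropy (marg12 ω) + entropy (marg23 ω) - entropy (marg2 ω) - entropy ω

/-- Systems `1` and `3` are quantum conditionally independent given system `2`. -/
def IsCondIndep (ω : Matrix (a × c × b) (a × c × b) ℂ) : Prop :=
  condMutualInfo ω = 0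

/-- The completions of a pair of prescribed marginals: strictly positive density operators on the
whole system with these marginals. -/
def completions (ρ₁₂ : Matrix (a × c) (a × c) ℂ) (ρ₂₃ : Matrix (c × b) (c × b) ℂ) :
    Set (Matrix (a × c × b) (a × c × b) ℂ) :=
  {ω | IsDensity ω ∧ marg12 ω = ρ₁₂ ∧ marg23 ω = ρ₂₃}

/-- A quantum Markov completion: a completion in which systems `1` and `3` are conditionally
independent given system `2`. -/
def IsMarkovCompletion (ρ₁₂ : Matrix (a × c) (a × c) ℂ) (ρ₂₃ : Matrix (c × b) (c × b) ℂ)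
    (ω : Matrix (a × c × b) (a × c × b) ℂ) : Prop :=
  ω ∈ completions ρ₁₂ ρ₂₃ ∧ IsCondIndep ω

/-- A completion of largest von Neumann entropy among all completions. -/
def IsMaxEntropyCompletion (ρ₁₂ : Matrix (a × c) (a × c) ℂ) (ρ₂₃ : Matrix (c × b) (c × b) ℂ)
    (ω : Matrix (a × c × b) (a × c × b) ℂ) : Prop :=
  ω ∈ completions ρ₁₂ ρ₂₃ ∧ ∀ ω' ∈ completions ρ₁₂ ρ₂₃, entropy ω' ≤ entropy ω

end Tripartite

/-- The Pauli matrix `X`. -/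
def pauliX : Matrix (Fin 2) (Fin 2) ℂ := !![0, 1; 1, 0]

/-- The Pauli matrix `Z`. -/
def pauliZ : Matrix (Fin 2) (Fin 2) ℂ := !![1, 0; 0, -1]

/-- The prescribed marginal `ρ₁₂ = (I + ε X ⊗ X) / 4`. -/
def exRho12 (ε : ℝ) : Matrix (Fin 2 × Fin 2) (Fin 2 × Fin 2) ℂ :=
  (1 / 4 : ℂ) • (1 + (ε : ℂ) • (pauliX ⊗ₖ pauliX))

/-- The prescribed marginal `ρ₂₃ = (I + δ Z ⊗ Z) / 4`. -/
def exRho23 (δ : ℝ) : Matrix (Fin 2 × Fin 2) (Fin 2 × Fin 2) ℂ :=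
  (1 / 4 : ℂ) • (1 + (δ : ℂ) • (pauliZ ⊗ₖ pauliZ))

/-- The Pauli word `W₁ = X ⊗ X ⊗ I`. -/
def word1 : Matrix (Fin 2 × Fin 2 × Fin 2) (Fin 2 × Fin 2 × Fin 2) ℂ :=
  pauliX ⊗ₖ (pauliX ⊗ₖ (1 : Matrix (Fin 2) (Fin 2) ℂ))

/-- The Pauli word `W₂ = I ⊗ Z ⊗ Z`. -/
def word2 : Matrix (Fin 2 × Fin 2 × Fin 2) (Fin 2 × Fin 2 × Fin 2) ℂ :=
  (1 : Matrix (Fin 2) (Fin 2) ℂ) ⊗ₖ (pauliZ ⊗ₖ pauliZ)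

/-- The operator `σ = (I + ε W₁ + δ W₂) / 8`. -/
def exSigma (ε δ : ℝ) : Matrix (Fin 2 × Fin 2 × Fin 2) (Fin 2 × Fin 2 × Fin 2) ℂ :=
  (1 / 8 : ℂ) • (1 + (ε : ℂ) • word1 + (δ : ℂ) • word2)

end

end QMarkov

/-! The two words anticommute (X meets Z on system 2) and square to 1, so `H = ε W₁ + δ W₂`
satisfies `H² = r²` with `r² = ε² + δ² < 1`, and `8 σ = 1 + H` has eigenvalues `1 ± r`. Hence `log
σ` is affine in `H`, a combination of observables on systems 12 and 23. All completions ω therefore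
share the value of `Tr (ω log σ)`, and the equality case of Klein's inequality
(`eq_of_trace_mul_log_le`) makes σ the unique entropy maximizer.

The marginals fix every entropy except `S(ω)`, so `I(1:3|2) = [φ(r) - φ(ε) - φ(δ)] + [S(σ) - S(ω)]`.
The second bracket is nonnegative by maximality. As φ is a power series in `x²` with positive
coefficients and no constant term, the first is positive when `ε δ ≠ 0`; it vanishes when `ε δ = 0`,
and then σ itself is Markov. -/

namespace QMarkov

open Matrix

/-! ### Power series and superadditivity of the entropy deficit -/

/-- The function `φ` with `S = log N - φ(r)` for a state on `N` levels whose eigenvalues are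
`(1 ± r) / N` with equal multiplicities. -/
noncomputable def entropyDeficit (x : ℝ) : ℝ :=
  ((1 + x) * Real.log (1 + x) + (1 - x) * Real.log (1 - x)) / 2

theorem entropyDeficit_zero : entropyDeficit 0 = 0 := by
  simp [entropyDeficit]

/-- Regroup `2 φ(x) = x (log (1 + x) - log (1 - x)) + log (1 - x²)` and combine the two logarithmic
series. What matters later is that all coefficients are positive. -/
theorem hasSum_entropyDeficit {x : ℝ} (hx : |x| < 1) :
    HasSum (fun k : ℕ => (1 / (2 * (2 * k + 1) * (k + 1)) : ℝ) * (x ^ 2) ^ (k + 1))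
      (entropyDeficit x) := by
  have hx2 : |x ^ 2| < 1 := by
    rw [abs_pow]; exact pow_lt_one₀ (abs_nonneg x) hx two_ne_zero
  have h := (((Real.hasSum_log_sub_log_of_abs_lt_one hx).mul_left x).sub
    (Real.hasSum_pow_div_log_of_abs_lt_one hx2)).div_const 2
  obtain ⟨h1, h2⟩ := abs_lt.mp hx
  have hlog : Real.log (1 - x ^ 2) = Real.log (1 + x) + Real.log (1 - x) := by
    rw [← Real.log_mul (by linarith) (by linarith)]
    ring_nf
  rw [hlog] at h
  have hterm : (fun k : ℕ => (1 / (2 * (2 * k + 1) * (k + 1)) : ℝ) * (x ^ 2) ^ (k + 1)) =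
      fun k : ℕ => (x * (2 * (1 / (2 * k + 1)) * x ^ (2 * k + 1)) -
        (x ^ 2) ^ (k + 1) / (k + 1)) / 2 := by
    funext k
    have : (2 * (k : ℝ) + 1) ≠ 0 := by positivity
    have : (k : ℝ) + 1 ≠ 0 := by positivity
    field_simp
    ring
  have hval : entropyDeficit x = (x * (Real.log (1 + x) - Real.log (1 - x)) -
      -(Real.log (1 + x) + Real.log (1 - x))) / 2 := by
    rw [entropyDeficit]
    ring
  rw [hterm, hval]
  exact h

/-- Strict superadditivity of the entropy deficit as a function of `x ^ 2`. -/
theorem entropyDeficit_add_lt {x y r : ℝ} (hr : |r| < 1) (h : r ^ 2 = x ^ 2 + y ^ 2)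
    (hxy : x * y ≠ 0) : entropyDeficit x + entropyDeficit y < entropyDeficit r := by
  have hr2 : r ^ 2 < 1 := (sq_lt_one_iff_abs_lt_one r).mpr hr
  have hx : |x| < 1 := (sq_lt_one_iff_abs_lt_one x).mp (by nlinarith [sq_nonneg y])
  have hy : |y| < 1 := (sq_lt_one_iff_abs_lt_one y).mp (by nlinarith [sq_nonneg x])
  -- The term `k = 0` is linear in `x²` and gives equality; strictness first appears at `k = 1`,
  -- through the cross term `2 x² y²`.
  refine hasSum_lt (i := 1) (fun k => ?_) ?_ ((hasSum_entropyDeficit hx).add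
    (hasSum_entropyDeficit hy)) (hasSum_entropyDeficit hr)
  · rw [← mul_add, h]
    gcongr
    exact pow_add_pow_le (sq_nonneg x) (sq_nonneg y) k.succ_ne_zero
  · have := pow_pos (abs_pos.mpr hxy) 2
    rw [sq_abs] at this
    rw [h]
    norm_num
    nlinarith

/-! ### Functional calculus and entropy for matrices with scalar square -/

/-- If `H * H = r ^ 2`, every function of `H` in the functional calculus is affine in `H`. -/
theorem exists_cfc_eq_affine {n : Type*} [Fintype n] [DecidableEq n] {H : Matrix n n ℂ}
    (hH : H.IsHermitian) {r : ℝ} (hr : H * H = ((r ^ 2 : ℝ) : ℂ) • 1) (f : ℝ → ℝ) :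
    cfc f H = (((f r + f (-r)) / 2 : ℝ) : ℂ) • (1 : Matrix n n ℂ) +
      (((f r - f (-r)) / (2 * r) : ℝ) : ℂ) • H := by
  have hspec : ∀ x ∈ spectrum ℝ H, x = r ∨ x = -r := by
    intro x hx
    have h1 := spectrum.pow_mem_pow H 2 hx
    have h2 : H ^ 2 = algebraMap ℝ (Matrix n n ℂ) (r ^ 2) := by
      rw [pow_two, hr, Algebra.algebraMap_eq_smul_one]
      exact (RCLike.real_smul_eq_coe_smul (K := ℂ) _ _).symm
    rw [h2] at h1
    rcases isEmpty_or_nonempty n with hn | hn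
    · exact absurd hx (by simp [spectrum.of_subsingleton])
    · rw [spectrum.scalar_eq] at h1
      exact sq_eq_sq_iff_eq_or_eq_neg.mp h1
  have hcongr : Set.EqOn f (fun x => (f r + f (-r)) / 2 + (f r - f (-r)) / (2 * r) * x)
      (spectrum ℝ H) := by
    intro x hx
    -- For `r = 0` the slope is `0` by the convention on division, which is harmless since the
    -- spectrum lies in `{0}`.
    by_cases h0 : r = 0
    · rcases hspec x hx with rfl | rfl <;> simp [h0]
    · rcases hspec x hx with rfl | rfl
      · simp only; field_simp; ring
      · simp only; field_simp; ring
  have hsa : IsSelfAdjoint H := hH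
  rw [cfc_congr hcongr, cfc_const_add _ _ _, cfc_const_mul_id _ _, Algebra.algebraMap_eq_smul_one]
  congr 1

theorem posDef_one_add {n : Type*} [Fintype n] [DecidableEq n] {H : Matrix n n ℂ}
    (hH : H.IsHermitian) {r : ℝ} (hr : H * H = ((r ^ 2 : ℝ) : ℂ) • 1) (hr1 : |r| < 1) :
    (1 + H).PosDef := by
  -- Positivity comes from `1 + H = (1 - r²)/2 + (1 + H)²/2`, valid because `H² = r²`.
  have hpos : (0 : ℝ) < (1 - r ^ 2) / 2 := by
    have := (sq_lt_one_iff_abs_lt_one r).mpr hr1; linarith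
  have h1 : ((((1 - r ^ 2) / 2 : ℝ) : ℂ) • (1 : Matrix n n ℂ)).PosDef :=
    PosDef.one.smul (by exact_mod_cast hpos)
  have h2 : ((1 / 2 : ℂ) • ((1 + H)ᴴ * (1 + H))).PosSemidef :=
    (posSemidef_conjTranspose_mul_self _).smul (by positivity)
  have h3 := h1.add_posSemidef h2
  have : (1 + H)ᴴ = 1 + H := by rw [conjTranspose_add, hH.eq, conjTranspose_one]
  rw [this] at h3
  convert h3 using 1
  rw [add_mul, mul_add, mul_add, hr]
  ext i j
  simp
  ring

theorem cfc_log_smul_one_add {n : Type*} [Fintype n] [DecidableEq n] {H : Matrix n n ℂ}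
    (hH : H.IsHermitian) {r : ℝ} (hr : H * H = ((r ^ 2 : ℝ) : ℂ) • 1) {c : ℝ} :
    cfc Real.log ((c : ℂ) • (1 + H)) =
      (((Real.log (c * (1 + r)) + Real.log (c * (1 - r))) / 2 : ℝ) : ℂ) • (1 : Matrix n n ℂ) +
      (((Real.log (c * (1 + r)) - Real.log (c * (1 - r))) / (2 * r) : ℝ) : ℂ) • H := by
  have hsa : IsSelfAdjoint H := hH
  have hA : (c : ℂ) • (1 + H) = cfc (fun x : ℝ => c * (1 + x)) H := by
    rw [cfc_const_mul _ _ _, cfc_const_add _ _ _, cfc_id' ℝ H, map_one]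
    exact (RCLike.real_smul_eq_coe_smul (K := ℂ) _ _).symm
  have hfin : (spectrum ℝ H).Finite := Matrix.finite_real_spectrum
  rw [hA, ← cfc_comp' Real.log _ H ((hfin.image _).continuousOn _), exists_cfc_eq_affine hH hr]
  simp only [sub_eq_add_neg]

theorem entropy_smul_one_add {n : Type*} [Fintype n] [DecidableEq n] [Nonempty n]
    {H : Matrix n n ℂ} (hH : H.IsHermitian) {r : ℝ} (hr : H * H = ((r ^ 2 : ℝ) : ℂ) • 1)
    (hr1 : |r| < 1) (htr : H.trace = 0) {c : ℝ} (hc : c = 1 / Fintype.card n) :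
    entropy ((c : ℂ) • (1 + H)) = -Real.log c - entropyDeficit r := by
  obtain ⟨h1, h2⟩ := abs_lt.mp hr1
  have hcard : (Fintype.card n : ℝ) ≠ 0 := by positivity
  have hc0 : c ≠ 0 := by rw [hc]; positivity
  have hcn : (Fintype.card n : ℂ) * c = 1 := by
    rw [hc]; push_cast; exact mul_one_div_cancel (by exact_mod_cast hcard)
  rw [entropy, cfc_log_smul_one_add hH hr]
  generalize hp : (Real.log (c * (1 + r)) + Real.log (c * (1 - r))) / 2 = p
  generalize hq : (Real.log (c * (1 + r)) - Real.log (c * (1 - r))) / (2 * r) = q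
  have : (((c : ℂ) • (1 + H)) * ((p : ℂ) • 1 + (q : ℂ) • H)).trace =
      ((p + q * r ^ 2 : ℝ) : ℂ) := by
    simp only [smul_mul_assoc, add_mul, mul_add, mul_smul_comm, one_mul, mul_one, hr, trace_smul,
      trace_add, htr, trace_one, smul_eq_mul]
    push_cast
    linear_combination ((p : ℂ) + q * r ^ 2) * hcn
  rw [this, Complex.ofReal_re, ← hp, ← hq, entropyDeficit,
    Real.log_mul hc0 (by linarith), Real.log_mul hc0 (by linarith)]
  by_cases h0 : r = 0
  · simp [h0]
  · field_simp
    ring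

/-! ### Klein's inequality -/

/-- Simultaneous spectral expansion of two Hermitian matrices. -/
theorem exists_trace_cfc_mul_cfc {n : Type*} [Fintype n] [DecidableEq n] {A B : Matrix n n ℂ}
    (hA : A.IsHermitian) (hB : B.IsHermitian) :
    ∃ W : Matrix n n ℂ,
      (∀ f g : ℝ → ℝ, (cfc f A * cfc g B).trace.re =
        ∑ i, ∑ j, f (hA.eigenvalues i) * g (hB.eigenvalues j) * Complex.normSq (W i j)) ∧
      ((∀ i j, W i j ≠ 0 → hA.eigenvalues i = hB.eigenvalues j) → A = B) := by
  set U := (hA.eigenvectorUnitary : Matrix n n ℂ) with hU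
  set V := (hB.eigenvectorUnitary : Matrix n n ℂ) with hV
  have hUU : U * star U = 1 := Unitary.coe_mul_star_self _
  have hVV : V * star V = 1 := Unitary.coe_mul_star_self _
  -- The entries of `W` are the overlaps of the two eigenbases. If `W` only links equal eigenvalues,
  -- it intertwines the two diagonal matrices, which forces `A = B`.
  refine ⟨star U * V, fun f g => ?_, fun h => ?_⟩
  · rw [hA.cfc_eq, hB.cfc_eq, IsHermitian.cfc, IsHermitian.cfc, Unitary.conjStarAlgAut_apply,
      Unitary.conjStarAlgAut_apply, ← hU, ← hV]
    set D := diagonal (RCLike.ofReal ∘ f ∘ hA.eigenvalues : n → ℂ) with hD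
    set E := diagonal (RCLike.ofReal ∘ g ∘ hB.eigenvalues : n → ℂ) with hE
    have : (U * D * star U * (V * E * star V)).trace =
        ((D * (star U * V)) * (E * star (star U * V))).trace := by
      rw [mul_assoc U, mul_assoc U, trace_mul_comm U]
      simp only [star_mul, star_star, mul_assoc]
    rw [this, trace, Complex.re_sum]
    refine Finset.sum_congr rfl fun i _ => ?_
    rw [diag_apply, mul_apply, Complex.re_sum]
    refine Finset.sum_congr rfl fun j _ => ?_
    rw [hD, hE, diagonal_mul, diagonal_mul, star_apply]
    generalize (star U * V) i j = w
    simp [Complex.normSq_apply]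
    ring
  · have hA' := hA.spectral_theorem
    have hB' := hB.spectral_theorem
    rw [Unitary.conjStarAlgAut_apply, ← hU] at hA'
    rw [Unitary.conjStarAlgAut_apply, ← hV] at hB'
    set D := diagonal (RCLike.ofReal ∘ hA.eigenvalues : n → ℂ) with hD
    set E := diagonal (RCLike.ofReal ∘ hB.eigenvalues : n → ℂ) with hE
    have hcomm : D * (star U * V) = (star U * V) * E := by
      ext i j
      rw [hD, hE, diagonal_mul, mul_diagonal]
      by_cases hw : (star U * V) i j = 0
      · simp [hw]
      · simp [h i j hw, mul_comm]
    calc A = U * D * star U * (V * star V) := by rw [hVV, mul_one, ← hA']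
      _ = U * (D * (star U * V)) * star V := by simp only [mul_assoc]
      _ = (U * star U) * V * E * star V := by rw [hcomm]; simp only [mul_assoc]
      _ = B := by rw [hUU, one_mul, ← hB']

/-- Klein's inequality with its equality case. -/
theorem eq_of_trace_mul_log_le {n : Type*} [Fintype n] [DecidableEq n] {A B : Matrix n n ℂ}
    (hA : A.PosDef) (hB : B.PosDef) (htr : A.trace = B.trace)
    (h : (A * cfc Real.log A).trace.re ≤ (A * cfc Real.log B).trace.re) : A = B := by
  obtain ⟨W, hW, hAB⟩ := exists_trace_cfc_mul_cfc hA.1 hB.1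
  have hsA : IsSelfAdjoint A := hA.1
  have hsB : IsSelfAdjoint B := hB.1
  have hfin : (spectrum ℝ A).Finite := Matrix.finite_real_spectrum
  -- These expand `Tr (A log A)`, `Tr (A log B)`, `Tr A` and `Tr B` over the same weights `|W i
  -- j|²`.
  have e1 := hW (fun x => x * Real.log x) (fun _ => 1)
  have e2 := hW (fun x => x) Real.log
  have e3 := hW (fun x => x) (fun _ => 1)
  have e4 := hW (fun _ => 1) (fun x => x)
  rw [cfc_mul (fun x => x) Real.log A (hfin.continuousOn _) (hfin.continuousOn _)] at e1
  simp only [cfc_id' ℝ A, cfc_id' ℝ B, cfc_const_one ℝ A, cfc_const_one ℝ B, mul_one,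
    one_mul] at e1 e2 e3 e4
  rw [htr] at e3
  refine hAB fun i j hij => ?_
  set p := hA.1.eigenvalues
  set q := hB.1.eigenvalues
  have hp : ∀ i, 0 < p i := hA.eigenvalues_pos
  have hq : ∀ i, 0 < q i := hB.eigenvalues_pos
  -- This is the strict inequality `log t < t - 1` at `t = q j / p i`, multiplied by `p i`.
  have key : ∀ i j, p i ≠ q j → p i * Real.log (q j) + p i - p i * Real.log (p i) < q j := by
    intro i j hne
    have h1 := Real.log_lt_sub_one_of_pos (div_pos (hq j) (hp i))
      (fun h => hne ((div_eq_one_iff_eq (hp i).ne').mp h).symm)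
    rw [Real.log_div (hq j).ne' (hp i).ne'] at h1
    have h2 := mul_lt_mul_of_pos_left h1 (hp i)
    have h3 : p i * (q j / p i - 1) = q j - p i := by
      have := (hp i).ne'
      field_simp
    linarith
  have hnn : ∀ i j, 0 ≤ (p i * Real.log (p i) - p i * Real.log (q j) - p i + q j) *
      Complex.normSq (W i j) := by
    intro i j
    refine mul_nonneg ?_ (Complex.normSq_nonneg _)
    by_cases hne : p i = q j
    · rw [hne]; linarith
    · linarith [key i j hne]
  have hsum : ∑ i, ∑ j, (p i * Real.log (p i) - p i * Real.log (q j) - p i + q j) *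
      Complex.normSq (W i j) ≤ 0 := by
    simp only [add_mul, sub_mul, Finset.sum_add_distrib, Finset.sum_sub_distrib]
    linarith
  have h0 := (Finset.sum_eq_zero_iff_of_nonneg fun i _ => Finset.sum_nonneg fun j _ => hnn i j).mp
    (le_antisymm hsum (Finset.sum_nonneg fun i _ => Finset.sum_nonneg fun j _ => hnn i j)) i
    (Finset.mem_univ i)
  have h1 := (Finset.sum_eq_zero_iff_of_nonneg fun j _ => hnn i j).mp h0 j (Finset.mem_univ j)
  by_contra hne
  rcases mul_eq_zero.mp h1 with h2 | h2
  · linarith [key i j hne]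
  · exact hij (Complex.normSq_eq_zero.mp h2)

/-! ### Pauli algebra -/

theorem pauliX_mul_self : pauliX * pauliX = 1 := by
  ext i j; fin_cases i <;> fin_cases j <;> simp [pauliX]

theorem pauliZ_mul_self : pauliZ * pauliZ = 1 := by
  ext i j; fin_cases i <;> fin_cases j <;> simp [pauliZ]

theorem pauliZ_mul_pauliX : pauliZ * pauliX = -(pauliX * pauliZ) := by
  ext i j; fin_cases i <;> fin_cases j <;> simp [pauliX, pauliZ]

theorem isHermitian_pauliX : pauliX.IsHermitian := by
  ext i j; fin_cases i <;> fin_cases j <;> simp [pauliX]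

theorem isHermitian_pauliZ : pauliZ.IsHermitian := by
  ext i j; fin_cases i <;> fin_cases j <;> simp [pauliZ]

theorem trace_pauliX : pauliX.trace = 0 := by simp [pauliX, trace_fin_two]

theorem trace_pauliZ : pauliZ.trace = 0 := by simp [pauliZ, trace_fin_two]

theorem isHermitian_kronecker {m n : Type*} {A : Matrix m m ℂ} {B : Matrix n n ℂ}
    (hA : A.IsHermitian) (hB : B.IsHermitian) : (A ⊗ₖ B).IsHermitian := by
  rw [IsHermitian, conjTranspose_kronecker, hA.eq, hB.eq]

theorem isHermitian_real_smul {n : Type*} {A : Matrix n n ℂ} (hA : A.IsHermitian) (t : ℝ) :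
    ((t : ℂ) • A).IsHermitian := by
  rw [IsHermitian, conjTranspose_smul, hA.eq]
  simp

theorem real_smul_mul_self {n : Type*} [Fintype n] [DecidableEq n] {A : Matrix n n ℂ}
    (hA : A * A = 1) (t : ℝ) : ((t : ℂ) • A) * ((t : ℂ) • A) = ((t ^ 2 : ℝ) : ℂ) • 1 := by
  rw [smul_mul_smul_comm, hA]
  push_cast
  rw [pow_two]

/-! ### Partial traces -/

section Marginals

variable {a c b : Type*}

theorem marg12_kronecker [Fintype b] (A : Matrix a a ℂ) (C : Matrix c c ℂ) (B : Matrix b b ℂ) :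
    marg12 (A ⊗ₖ (C ⊗ₖ B)) = B.trace • (A ⊗ₖ C) := by
  ext ⟨i, j⟩ ⟨i', j'⟩
  simp [marg12, traceSnd, trace, Finset.sum_mul]
  exact Finset.sum_congr rfl fun x _ => by ring

theorem marg23_kronecker [Fintype a] (A : Matrix a a ℂ) (C : Matrix c c ℂ) (B : Matrix b b ℂ) :
    marg23 (A ⊗ₖ (C ⊗ₖ B)) = A.trace • (C ⊗ₖ B) := by
  ext ⟨i, j⟩ ⟨i', j'⟩
  simp [marg23, traceFst, trace, Finset.sum_mul]

theorem traceSnd_kronecker [Fintype b] (C : Matrix c c ℂ) (B : Matrix b b ℂ) :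
    traceSnd (C ⊗ₖ B) = B.trace • C := by
  ext i i'
  simp [traceSnd, trace, Finset.mul_sum, mul_comm]

theorem marg12_add [Fintype b] (M N : Matrix (a × c × b) (a × c × b) ℂ) :
    marg12 (M + N) = marg12 M + marg12 N := by
  ext; simp [marg12, traceSnd, Finset.sum_add_distrib]

theorem marg12_smul [Fintype b] (t : ℂ) (M : Matrix (a × c × b) (a × c × b) ℂ) :
    marg12 (t • M) = t • marg12 M := by
  ext; simp [marg12, traceSnd, Finset.mul_sum]

theorem marg23_add [Fintype a] (M N : Matrix (a × c × b) (a × c × b) ℂ) :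
    marg23 (M + N) = marg23 M + marg23 N := by
  ext; simp [marg23, traceFst, Finset.sum_add_distrib]

theorem marg23_smul [Fintype a] (t : ℂ) (M : Matrix (a × c × b) (a × c × b) ℂ) :
    marg23 (t • M) = t • marg23 M := by
  ext; simp [marg23, traceFst, Finset.mul_sum]

theorem traceSnd_add [Fintype b] (M N : Matrix (c × b) (c × b) ℂ) :
    traceSnd (M + N) = traceSnd M + traceSnd N := by
  ext; simp [traceSnd, Finset.sum_add_distrib]

theorem traceSnd_smul [Fintype b] (t : ℂ) (M : Matrix (c × b) (c × b) ℂ) :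
    traceSnd (t • M) = t • traceSnd M := by
  ext; simp [traceSnd, Finset.mul_sum]

/-- Partial trace is adjoint to tensoring with the identity: an observable on systems 1, 2 only sees
that marginal. -/
theorem trace_mul_kronecker_one [Fintype a] [Fintype c] [Fintype b] [DecidableEq b]
    (ω : Matrix (a × c × b) (a × c × b) ℂ)
    (A : Matrix a a ℂ) (C : Matrix c c ℂ) :
    (ω * (A ⊗ₖ (C ⊗ₖ (1 : Matrix b b ℂ)))).trace = (marg12 ω * (A ⊗ₖ C)).trace := by
  simp only [trace, diag_apply, mul_apply, Fintype.sum_prod_type, kroneckerMap_apply, one_apply,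
    marg12, traceSnd, of_apply, submatrix_apply, Equiv.prodAssoc_apply, Finset.sum_mul, mul_ite,
    mul_one, mul_zero, Finset.sum_ite_eq', Finset.mem_univ, if_true]
  refine Finset.sum_congr rfl fun i _ => Finset.sum_congr rfl fun j _ => ?_
  rw [Finset.sum_comm]
  refine Finset.sum_congr rfl fun i' _ => ?_
  rw [Finset.sum_comm]

theorem trace_mul_one_kronecker [Fintype a] [Fintype c] [Fintype b] [DecidableEq a]
    (ω : Matrix (a × c × b) (a × c × b) ℂ)
    (M : Matrix (c × b) (c × b) ℂ) :
    (ω * ((1 : Matrix a a ℂ) ⊗ₖ M)).trace = (marg23 ω * M).trace := by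
  simp only [trace, diag_apply, mul_apply, Fintype.sum_prod_type (α₁ := a), kroneckerMap_apply,
    one_apply, marg23, traceFst, of_apply, Finset.sum_mul, ite_mul, mul_ite, one_mul, mul_zero,
    zero_mul]
  rw [Finset.sum_comm]
  refine Finset.sum_congr rfl fun x _ => ?_
  rw [Finset.sum_comm]
  simp only [Finset.sum_comm (s := (Finset.univ : Finset (c × b))), Finset.sum_ite_irrel,
    Finset.sum_const_zero, Finset.sum_ite_eq, Finset.mem_univ, if_true]

end Marginals

/-! ### The state σ and the entropies of its marginals -/

theorem kronecker_one_one : (1 : Matrix (Fin 2 × Fin 2 × Fin 2) (Fin 2 × Fin 2 × Fin 2) ℂ) =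
    (1 : Matrix (Fin 2) (Fin 2) ℂ) ⊗ₖ ((1 : Matrix (Fin 2) (Fin 2) ℂ) ⊗ₖ
      (1 : Matrix (Fin 2) (Fin 2) ℂ)) := by
  rw [one_kronecker_one, one_kronecker_one]

theorem marg12_exSigma (ε δ : ℝ) : marg12 (exSigma ε δ) = exRho12 ε := by
  rw [exSigma, exRho12, kronecker_one_one, word1, word2, ← one_kronecker_one]
  simp only [marg12_smul, marg12_add, marg12_kronecker, trace_pauliZ, trace_one, Fintype.card_fin]
  module

theorem marg23_exSigma (ε δ : ℝ) : marg23 (exSigma ε δ) = exRho23 δ := by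
  rw [exSigma, exRho23, kronecker_one_one, word1, word2, ← one_kronecker_one]
  simp only [marg23_smul, marg23_add, marg23_kronecker, trace_pauliX, trace_one, Fintype.card_fin]
  module

/-- The form `1 + 0` lets `entropy_smul_one_add` apply with `H = 0` and `r = 0`. -/
theorem traceSnd_exRho23 (δ : ℝ) : traceSnd (exRho23 δ) = ((1 / 2 : ℝ) : ℂ) • (1 + 0) := by
  rw [exRho23, ← one_kronecker_one]
  simp only [traceSnd_smul, traceSnd_add, traceSnd_kronecker, trace_pauliZ, trace_one,
    Fintype.card_fin]
  push_cast
  module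

theorem word1_mul_self : word1 * word1 = 1 := by
  simp [word1, ← mul_kronecker_mul, pauliX_mul_self]

theorem word2_mul_self : word2 * word2 = 1 := by
  simp [word2, ← mul_kronecker_mul, pauliZ_mul_self]

theorem word2_mul_word1 : word2 * word1 = -(word1 * word2) := by
  simp only [word1, word2, ← mul_kronecker_mul, pauliZ_mul_pauliX, one_mul, mul_one]
  ext ⟨i, j, k⟩ ⟨i', j', k'⟩
  simp

/-- The traceless part of `8 σ`. -/
noncomputable def exHam (ε δ : ℝ) : Matrix (Fin 2 × Fin 2 × Fin 2) (Fin 2 × Fin 2 × Fin 2) ℂ :=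
  (ε : ℂ) • word1 + (δ : ℂ) • word2

theorem exSigma_eq (ε δ : ℝ) : exSigma ε δ = ((1 / 8 : ℝ) : ℂ) • (1 + exHam ε δ) := by
  rw [exSigma, exHam, add_assoc]
  norm_num

theorem isHermitian_exHam (ε δ : ℝ) : (exHam ε δ).IsHermitian :=
  (isHermitian_real_smul (isHermitian_kronecker isHermitian_pauliX
    (isHermitian_kronecker isHermitian_pauliX isHermitian_one)) ε).add
  (isHermitian_real_smul (isHermitian_kronecker isHermitian_one
    (isHermitian_kronecker isHermitian_pauliZ isHermitian_pauliZ)) δ)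

/-- The cross terms cancel because the words anticommute. -/
theorem exHam_mul_self (ε δ : ℝ) :
    exHam ε δ * exHam ε δ = ((Real.sqrt (ε ^ 2 + δ ^ 2) ^ 2 : ℝ) : ℂ) • 1 := by
  rw [Real.sq_sqrt (by positivity), exHam]
  simp only [add_mul, mul_add, smul_mul_smul_comm, word1_mul_self, word2_mul_self,
    word2_mul_word1]
  push_cast
  module

theorem trace_exHam (ε δ : ℝ) : (exHam ε δ).trace = 0 := by
  simp [exHam, word1, word2, trace_kronecker, trace_pauliX, trace_pauliZ]

theorem abs_sqrt_lt_one {ε δ : ℝ} (h : ε ^ 2 + δ ^ 2 < 1) : |Real.sqrt (ε ^ 2 + δ ^ 2)| < 1 := by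
  rw [abs_of_nonneg (Real.sqrt_nonneg _), Real.sqrt_lt' one_pos]
  simpa using h

theorem isDensity_exSigma {ε δ : ℝ} (h : ε ^ 2 + δ ^ 2 < 1) : IsDensity (exSigma ε δ) := by
  rw [exSigma_eq]
  refine ⟨(posDef_one_add (isHermitian_exHam ε δ) (exHam_mul_self ε δ) (abs_sqrt_lt_one h)).smul
    (by rw [Complex.zero_lt_real]; norm_num), ?_⟩
  rw [trace_smul, trace_add, trace_exHam, trace_one]
  norm_num [Fintype.card_prod]

theorem exSigma_mem_completions {ε δ : ℝ} (h : ε ^ 2 + δ ^ 2 < 1) :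
    exSigma ε δ ∈ completions (exRho12 ε) (exRho23 δ) :=
  ⟨isDensity_exSigma h, marg12_exSigma ε δ, marg23_exSigma ε δ⟩

theorem entropy_exSigma {ε δ : ℝ} (h : ε ^ 2 + δ ^ 2 < 1) :
    entropy (exSigma ε δ) = -Real.log (1 / 8) - entropyDeficit (Real.sqrt (ε ^ 2 + δ ^ 2)) := by
  rw [exSigma_eq]
  exact entropy_smul_one_add (isHermitian_exHam ε δ) (exHam_mul_self ε δ) (abs_sqrt_lt_one h)
    (trace_exHam ε δ) (by norm_num [Fintype.card_prod])

theorem entropy_exRho12 {ε : ℝ} (h : |ε| < 1) :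
    entropy (exRho12 ε) = -Real.log (1 / 4) - entropyDeficit ε := by
  have : exRho12 ε = ((1 / 4 : ℝ) : ℂ) • (1 + (ε : ℂ) • (pauliX ⊗ₖ pauliX)) := by
    rw [exRho12]; norm_num
  rw [this]
  exact entropy_smul_one_add
    (isHermitian_real_smul (isHermitian_kronecker isHermitian_pauliX isHermitian_pauliX) ε)
    (real_smul_mul_self (by rw [← mul_kronecker_mul, pauliX_mul_self, one_kronecker_one]) ε) h
    (by rw [trace_smul, trace_kronecker, trace_pauliX]; simp) (by norm_num [Fintype.card_prod])

theorem entropy_exRho23 {δ : ℝ} (h : |δ| < 1) :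
    entropy (exRho23 δ) = -Real.log (1 / 4) - entropyDeficit δ := by
  have : exRho23 δ = ((1 / 4 : ℝ) : ℂ) • (1 + (δ : ℂ) • (pauliZ ⊗ₖ pauliZ)) := by
    rw [exRho23]; norm_num
  rw [this]
  exact entropy_smul_one_add
    (isHermitian_real_smul (isHermitian_kronecker isHermitian_pauliZ isHermitian_pauliZ) δ)
    (real_smul_mul_self (by rw [← mul_kronecker_mul, pauliZ_mul_self, one_kronecker_one]) δ) h
    (by rw [trace_smul, trace_kronecker, trace_pauliZ]; simp) (by norm_num [Fintype.card_prod])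

theorem entropy_traceSnd_exRho23 (δ : ℝ) :
    entropy (traceSnd (exRho23 δ)) = -Real.log (1 / 2) := by
  rw [traceSnd_exRho23, entropy_smul_one_add (r := 0) isHermitian_zero (by simp) (by simp)
    (by simp) (by simp), entropyDeficit_zero, sub_zero]

/-! ### Maximality of σ and strict positivity of the mutual information -/

/-- The marginals determine all terms of the conditional mutual information but the last. -/
theorem condMutualInfo_of_mem_completions {ε δ : ℝ} (h : ε ^ 2 + δ ^ 2 < 1)
    {ω : Matrix (Fin 2 × Fin 2 × Fin 2) (Fin 2 × Fin 2 × Fin 2) ℂ}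
    (hω : ω ∈ completions (exRho12 ε) (exRho23 δ)) :
    condMutualInfo ω = entropyDeficit (Real.sqrt (ε ^ 2 + δ ^ 2)) - entropyDeficit ε -
      entropyDeficit δ + (entropy (exSigma ε δ) - entropy ω) := by
  have hε : |ε| < 1 := (sq_lt_one_iff_abs_lt_one ε).mp (by nlinarith [sq_nonneg δ])
  have hδ : |δ| < 1 := (sq_lt_one_iff_abs_lt_one δ).mp (by nlinarith [sq_nonneg ε])
  have h4 : Real.log (1 / 4) = 2 * Real.log (1 / 2) := by
    rw [show (1 / 4 : ℝ) = (1 / 2) ^ 2 by norm_num, Real.log_pow]; norm_num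
  have h8 : Real.log (1 / 8) = 3 * Real.log (1 / 2) := by
    rw [show (1 / 8 : ℝ) = (1 / 2) ^ 3 by norm_num, Real.log_pow]; norm_num
  rw [condMutualInfo, marg2, hω.2.1, hω.2.2, entropy_exRho12 hε, entropy_exRho23 hδ,
    entropy_traceSnd_exRho23, entropy_exSigma h, h4, h8]
  ring

theorem trace_mul_exHam {ε δ : ℝ}
    {ω ω' : Matrix (Fin 2 × Fin 2 × Fin 2) (Fin 2 × Fin 2 × Fin 2) ℂ}
    (h12 : marg12 ω = marg12 ω') (h23 : marg23 ω = marg23 ω') :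
    (ω * exHam ε δ).trace = (ω' * exHam ε δ).trace := by
  simp only [exHam, word1, word2, mul_add, mul_smul_comm, trace_add, trace_smul,
    trace_mul_kronecker_one, trace_mul_one_kronecker, h12, h23]

/-- Since `log σ` is affine in `exHam`, whose expectation the marginals determine, `Tr (ω log σ) =
Tr (σ log σ)`. The entropy hypothesis thus becomes the reverse of Klein's inequality, which forces
equality. -/
theorem eq_exSigma_of_entropy_le {ε δ : ℝ} (h : ε ^ 2 + δ ^ 2 < 1)
    {ω : Matrix (Fin 2 × Fin 2 × Fin 2) (Fin 2 × Fin 2 × Fin 2) ℂ}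
    (hω : ω ∈ completions (exRho12 ε) (exRho23 δ)) (hle : entropy (exSigma ε δ) ≤ entropy ω) :
    ω = exSigma ε δ := by
  have hσ := exSigma_mem_completions h
  refine eq_of_trace_mul_log_le hω.1.1 hσ.1.1 (hω.1.2.trans hσ.1.2.symm) ?_
  have : (ω * cfc Real.log (exSigma ε δ)).trace =
      (exSigma ε δ * cfc Real.log (exSigma ε δ)).trace := by
    conv_lhs => rw [exSigma_eq]
    conv_rhs => enter [1, 2]; rw [exSigma_eq]
    rw [cfc_log_smul_one_add (isHermitian_exHam ε δ) (exHam_mul_self ε δ)]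
    simp only [mul_add, mul_smul_comm, mul_one, trace_add, trace_smul, hω.1.2, hσ.1.2,
      trace_mul_exHam (hω.2.1.trans hσ.2.1.symm) (hω.2.2.trans hσ.2.2.symm)]
  rw [this]
  simpa only [entropy, neg_le_neg_iff] using hle

theorem entropy_le_entropy_exSigma {ε δ : ℝ} (h : ε ^ 2 + δ ^ 2 < 1)
    {ω : Matrix (Fin 2 × Fin 2 × Fin 2) (Fin 2 × Fin 2 × Fin 2) ℂ}
    (hω : ω ∈ completions (exRho12 ε) (exRho23 δ)) : entropy ω ≤ entropy (exSigma ε δ) := by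
  rcases le_total (entropy ω) (entropy (exSigma ε δ)) with hle | hle
  · exact hle
  · rw [eq_exSigma_of_entropy_le h hω hle]

theorem condMutualInfo_pos {ε δ : ℝ} (h : ε ^ 2 + δ ^ 2 < 1) (hne : ε * δ ≠ 0)
    {ω : Matrix (Fin 2 × Fin 2 × Fin 2) (Fin 2 × Fin 2 × Fin 2) ℂ}
    (hω : ω ∈ completions (exRho12 ε) (exRho23 δ)) : 0 < condMutualInfo ω := by
  rw [condMutualInfo_of_mem_completions h hω]
  linarith [entropy_le_entropy_exSigma h hω,
    entropyDeficit_add_lt (abs_sqrt_lt_one h) (Real.sq_sqrt (by positivity)) hne]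

theorem entropyDeficit_abs (x : ℝ) : entropyDeficit |x| = entropyDeficit x := by
  rcases abs_choice x with h | h <;> rw [h]
  simp only [entropyDeficit, sub_neg_eq_add, ← sub_eq_add_neg]
  rw [add_comm]

theorem isCondIndep_exSigma {ε δ : ℝ} (h : ε ^ 2 + δ ^ 2 < 1) (h0 : ε * δ = 0) :
    IsCondIndep (exSigma ε δ) := by
  rw [IsCondIndep, condMutualInfo_of_mem_completions h (exSigma_mem_completions h)]
  -- Here `r` is the absolute value of the remaining parameter, and φ is even with `φ(0) = 0`.
  rcases mul_eq_zero.mp h0 with rfl | rfl <;>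
    simp [Real.sqrt_sq_eq_abs, entropyDeficit_abs, entropyDeficit_zero]

end QMarkov

theorem mainTheorem9 (ε δ : ℝ) (h : ε ^ 2 + δ ^ 2 < 1) :
    (QMarkov.completions (QMarkov.exRho12 ε) (QMarkov.exRho23 δ)).Nonempty ∧
    ((∃ ω, QMarkov.IsMarkovCompletion (QMarkov.exRho12 ε) (QMarkov.exRho23 δ) ω) ↔ ε * δ = 0) ∧
    (∀ ω, QMarkov.IsMaxEntropyCompletion (QMarkov.exRho12 ε) (QMarkov.exRho23 δ) ω ↔
      ω = QMarkov.exSigma ε δ) ∧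
    (ε * δ ≠ 0 → ¬ QMarkov.IsCondIndep (QMarkov.exSigma ε δ)) := by
  have hσ := QMarkov.exSigma_mem_completions h
  refine ⟨⟨_, hσ⟩, ⟨?_, fun h0 => ⟨_, hσ, QMarkov.isCondIndep_exSigma h h0⟩⟩, fun ω => ⟨?_, ?_⟩,
    fun hne => (QMarkov.condMutualInfo_pos h hne hσ).ne'⟩
  · rintro ⟨ω, hω, hI⟩
    by_contra hne
    exact (QMarkov.condMutualInfo_pos h hne hω).ne' hI
  · rintro ⟨hω, hmax⟩
    exact QMarkov.eq_exSigma_of_entropy_le h hω (hmax _ hσ)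
  · rintro rfl
    exact ⟨hσ, fun ω' hω' => QMarkov.entropy_le_entropy_exSigma h hω'⟩
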